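/- Let $B=(b_1,b_2,b_3)\in\mathbb{R}^3$ with $|B|=1$ and $b_2>0$, and let $A:\mathbb{R}^3\to\mathbb{R}^3$ be any linear vector field with $\operatorname{curl}A=B$. For $\alpha\in(0,\pi)$ let $\mathcal{W}_\alpha=\{x\in\mathbb{R}^3:\ |x_2|\le x_1\tan\frac{\alpha}{2}\}$ be the infinite wedge of opening $\alpha$, and let $E(B,\mathcal{W}_\alpha)$ be the bottom of the spectrum of the Neumann magnetic Laplacian $(-i\nabla-A)^2$ on $\mathcal{W}_\alpha$, i.e. of the self-adjoint operator on $L^2(\mathcal{W}_\alpha)$ associated with the closed quadratic form $u\mapsto\int_{\mathcal{W}_\alpha}|(-i\nabla-A)u|^2\,dx$ with domain $\{u\in L^2(\mathcal{W}_\alpha):\ (-i\nabla-A)u\in L^2(\mathcal{W}_\alpha)^3\}$ (by gauge invariance it depends on $A$ only through $B$). For $\tau\in\mathbb{R}$ let $\zeta(\tau)$ be the first eigenvalue of the self-adjoint operator on $L^2(\mathbb{R}_+,r\,dr)$ associated with the closed quadratic form $u\mapsto\int_0^\infty\left(|u'(r)|^2+(r-\tau)^2|u(r)|^2\right)r\,dr$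 with domain $\{u\in L^2(\mathbb{R}_+,r\,dr):\ u'\in L^2(\mathbb{R}_+,r\,dr),\ ru\in L^2(\mathbb{R}_+,r\,dr)\}$, and let $\Xi_0=\inf_{\tau\in\mathbb{R}}\zeta(\tau)$. Then $$\limsup_{\alpha\to0^+}E(B,\mathcal{W}_\alpha)\le b_2\,\Xi_0 .$$ -/

import Mathlib

noncomputable section

namespace MagneticWedge

open MeasureTheory Filter Topology
open scoped ContDiff

/-! ### Operators associated with quadratic forms, and their spectra

Unbounded operators are represented by their graphs. -/

section Operators

variable {H K : Type*} [NormedAddCommGroup H] [InnerProductSpace ℂ H]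
  [NormedAddCommGroup K] [InnerProductSpace ℂ K]

/-- Let `T` be the graph of a linear operator `H ⊇ Dom T → K`. This is the graph of the operator
`L` on `H` associated with the quadratic form `q(u) = ‖T u‖²` on the form domain `Dom T`:
`u ∈ Dom L` and `L u = f` if and only if `u ∈ Dom T` and
`⟪T v, T u⟫ = ⟪v, f⟫` for all `v ∈ Dom T`. -/
def formOperator (T : Set (H × K)) : Set (H × H) :=
  {p | ∃ w : K, (p.1, w) ∈ T ∧
    ∀ (v : H) (z : K), (v, z) ∈ T → inner ℂ z w = inner ℂ v p.2}

/-- The resolvent set of the operator with graph `L`: the `μ : ℂ` for which `L - μ` is a bijection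
from `Dom L` onto `H` with a bounded inverse `R`. -/
def resolventOf (L : Set (H × H)) : Set ℂ :=
  {μ | ∃ R : H →L[ℂ] H,
    (∀ g : H, (R g, g + μ • R g) ∈ L) ∧
    (∀ u f : H, (u, f) ∈ L → R (f - μ • u) = u)}

/-- The spectrum of the operator with graph `L`. -/
def spectrumOf (L : Set (H × H)) : Set ℂ := (resolventOf L)ᶜ

/-- The bottom of the spectrum of a self-adjoint operator (its spectrum is real), as an extended
real number; the infimum of the empty set is `⊤`. -/
def bottomOfSpectrum (L : Set (H × H)) : EReal :=
  ⨅ (t : ℝ) (_ : (t : ℂ) ∈ spectrumOf L), (t : EReal)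

/-- The real number `t` is an eigenvalue of the operator with graph `L`. -/
def IsEigenvalue (L : Set (H × H)) (t : ℝ) : Prop :=
  ∃ u : H, u ≠ 0 ∧ (u, (t : ℂ) • u) ∈ L

/-- The lowest eigenvalue of a self-adjoint operator, as an extended real number. -/
def firstEigenvalue (L : Set (H × H)) : EReal :=
  ⨅ (t : ℝ) (_ : IsEigenvalue L t), (t : EReal)

end Operators

/-! ### Weak derivatives -/

/-- On the open set `Ω`, the function `v` is the weak derivative of `u` in the direction `e`
(both are meant to be locally integrable on `Ω`). -/
def HasWeakDeriv {E : Type*} [NormedAddCommGroup E] [NormedSpace ℝ E] [MeasureSpace E]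
    (Ω : Set E) (e : E) (u v : E → ℂ) : Prop :=
  ∀ φ : E → ℂ, ContDiff ℝ ∞ φ → HasCompactSupport φ → tsupport φ ⊆ Ω →
    ∫ x in Ω, u x * fderiv ℝ φ x e = -∫ x in Ω, v x * φ x

/-! ### The magnetic Laplacian with natural Neumann boundary condition -/

/-- Three-dimensional Euclidean space; `x 0`, `x 1`, `x 2` are the coordinates `x₁`, `x₂`, `x₃`. -/
abbrev Space := EuclideanSpace ℝ (Fin 3)

/-- The `j`-th vector of the canonical basis. -/
def stdVec (j : Fin 3) : Space := EuclideanSpace.single j (1 : ℝ)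

/-- The (constant) curl of a linear vector field `A = (a₁, a₂, a₃)`; here
`∂ᵢ aⱼ = (A eᵢ)ⱼ`. -/
def curl (A : Space →ₗ[ℝ] Space) : Space :=
  !₂[A (stdVec 1) 2 - A (stdVec 2) 1,
     A (stdVec 2) 0 - A (stdVec 0) 2,
     A (stdVec 0) 1 - A (stdVec 1) 0]

/-- `L²(Ω)`, complex valued, for Lebesgue measure. -/
abbrev L2 (Ω : Set Space) := Lp ℂ 2 (volume.restrict Ω)

/-- The graph of the magnetic gradient `u ↦ (-i∇ - A) u` on the open set `Ω`, with the maximal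
domain `{u ∈ L²(Ω) | (-i∇ - A) u ∈ L²(Ω)³}`. The equation `-i ∂ⱼ u - aⱼ u = wⱼ` is written
as `∂ⱼ u = i (wⱼ + aⱼ u)`. -/
def magneticGradient (A : Space →ₗ[ℝ] Space) (Ω : Set Space) :
    Set (L2 Ω × PiLp 2 (fun _ : Fin 3 => L2 Ω)) :=
  {p | ∀ j : Fin 3, HasWeakDeriv Ω (stdVec j) (p.1 : Space → ℂ)
    (fun x => Complex.I * ((p.2 j : Space → ℂ) x + ((A x j : ℝ) : ℂ) * (p.1 : Space → ℂ) x))}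

/-- The Neumann magnetic Laplacian `H(A, Ω) = (-i∇ - A)²` on the open set `Ω`: the self-adjoint
operator associated with the form `u ↦ ∫_Ω |(-i∇ - A) u|²` on its maximal domain. -/
def magneticLaplacian (A : Space →ₗ[ℝ] Space) (Ω : Set Space) : Set (L2 Ω × L2 Ω) :=
  formOperator (magneticGradient A Ω)

/-- The bottom of the spectrum of `H(A, Ω)`. -/
def groundEnergy (A : Space →ₗ[ℝ] Space) (Ω : Set Space) : EReal :=
  bottomOfSpectrum (magneticLaplacian A Ω)

/-- The closed wedge of opening `α ∈ (0, 2π)`: the product of the sector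
`|x₂| ≤ x₁ tan (α/2)` (if `α < π`), the half-plane `0 ≤ x₁` (if `α = π`), or the sector
`|x₂| ≥ x₁ tan (α/2)` (if `π < α`), and of the real line. -/
def wedge (α : ℝ) : Set Space :=
  {x | (α < Real.pi ∧ |x 1| ≤ x 0 * Real.tan (α / 2)) ∨
       (α = Real.pi ∧ 0 ≤ x 0) ∨
       (Real.pi < α ∧ x 0 * Real.tan (α / 2) ≤ |x 1|)}

/-! ### The auxiliary problem on the half-line -/

/-- The measure `r dr` on `(0, ∞)`. -/
def radialMeasure : Measure ℝ :=
  (volume.restrict (Set.Ioi (0 : ℝ))).withDensity (fun r => ENNReal.ofReal r)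

/-- `L²_r(ℝ₊)`, complex valued: square integrable functions for the weight `r dr`. -/
abbrev L2r := Lp ℂ 2 radialMeasure

/-- The graph of `u ↦ (u', (r - τ) u)` from `L²_r(ℝ₊)` to `L²_r(ℝ₊)²` with the maximal domain.
As `u ∈ L²_r`, the condition `(r - τ) u ∈ L²_r` is the same as `r u ∈ L²_r`, so that the domain
is `B¹_r(ℝ₊) = {u ∈ L²_r | u' ∈ L²_r, r u ∈ L²_r}`. -/
def radialGradient (τ : ℝ) : Set (L2r × PiLp 2 (fun _ : Fin 2 => L2r)) :=
  {p | HasWeakDeriv (Set.Ioi (0 : ℝ)) 1 (p.1 : ℝ → ℂ) (p.2 0 : ℝ → ℂ) ∧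
    (p.2 1 : ℝ → ℂ) =ᵐ[radialMeasure] fun r => ((r - τ : ℝ) : ℂ) * (p.1 : ℝ → ℂ) r}

/-- The self-adjoint operator `𝔤_τ` associated with the closed quadratic form
`u ↦ ∫₀^∞ (|u'(r)|² + (r - τ)² |u(r)|²) r dr` on `B¹_r(ℝ₊)`. -/
def radialOperator (τ : ℝ) : Set (L2r × L2r) := formOperator (radialGradient τ)

/-- `ζ(τ)`, the first eigenvalue of `𝔤_τ`. -/
def zeta (τ : ℝ) : EReal := firstEigenvalue (radialOperator τ)

/-- The constant `Ξ₀ = inf_τ ζ(τ)`. -/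
def Xi0 : EReal := ⨅ τ : ℝ, zeta τ

end MagneticWedge

end

/-!
By gauge invariance we may use the potential `(-b₃ x₂, 0, b₁ x₂ - b₂ x₁)`. Test the form on the
wedge of slope `T = tan (α/2)` with `exp (iθ) f(√b₂ x₁) g(T x₃)`, where `f` lies in the form domain
of the half-line problem and `g` is a cut-off. The trial function does not depend on `x₂`, and
integrating `x₂` over `|x₂| < T x₁` turns Lebesgue measure on the wedge into `2T` times the weight
`r dr`; this is where the half-line problem comes from. As `|x₂| ≤ T x₁`, the field components `b₁`
and `b₃` contribute `O(T)` to the magnetic gradient, and so does the derivative of `g`. Hence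
the Rayleigh quotient tends to `b₂` times that of `f`.

The Rayleigh quotient bounds the bottom of the spectrum because the resolvent at `-1` is the
positive operator `P P†`, with `P` the projection of the graph of the gradient to `L²`: its norm is
in its spectrum, and `‖P P†‖⁻¹ - 1` is the infimum of the Rayleigh quotients.
-/

noncomputable section

namespace MagneticWedge

open MeasureTheory Filter Topology
open scoped ContDiff ENNReal

/-! ### The variational upper bound -/

theorem norm_sq_eq_of_mem_formOperator {H K : Type*} [NormedAddCommGroup H] [InnerProductSpace ℂ H]
    [NormedAddCommGroup K] [InnerProductSpace ℂ K] {S : Set (H × K)} {u : H}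
    {t : ℝ} (h : (u, (t : ℂ) • u) ∈ formOperator S) : ∃ w, (u, w) ∈ S ∧ ‖w‖ ^ 2 = t * ‖u‖ ^ 2 := by
  obtain ⟨w, huw, hform⟩ := h
  refine ⟨w, huw, Complex.ofReal_injective ?_⟩
  simpa [inner_smul_right, inner_self_eq_norm_sq_to_K] using hform u w huw

section Resolvent

variable {H : Type*} [NormedAddCommGroup H] [InnerProductSpace ℂ H]
  {L : Set (H × H)} {μ ν : ℂ} {R S : H →L[ℂ] H}

/-- `R` is the resolvent at `μ` of the operator with graph `L`, that is, the bounded inverse of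
`L - μ`; these are the witnesses required by `resolventOf`. -/
def IsResolventAt (L : Set (H × H)) (μ : ℂ) (R : H →L[ℂ] H) : Prop :=
  (∀ g : H, (R g, g + μ • R g) ∈ L) ∧ ∀ u f : H, (u, f) ∈ L → R (f - μ • u) = u

theorem IsResolventAt.sub_eq_smul_mul (hR : IsResolventAt L ν R) (hS : IsResolventAt L μ S) :
    S - R = (μ - ν) • (R * S) := by
  ext g
  have h : R (g + (μ - ν) • S g) = S g := by
    rw [sub_smul, ← add_sub_assoc]
    exact hR.2 _ _ (hS.1 g)
  rw [map_add, map_smul] at h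
  simpa [sub_eq_iff_eq_add'] using h.symm

theorem IsResolventAt.inv_sub_notMem_spectrum (hR : IsResolventAt L ν R)
    (hS : IsResolventAt L μ S) (hμν : μ ≠ ν) : (μ - ν)⁻¹ ∉ spectrum ℂ R := by
  have hRS := hR.sub_eq_smul_mul hS
  have hSR : S - R = (μ - ν) • (S * R) := by
    rw [← neg_sub R, hS.sub_eq_smul_mul hR, ← neg_smul, neg_sub]
  set c := μ - ν
  have hc : c ≠ 0 := sub_ne_zero.2 hμν
  have h₁ : (1 - c • R) * (1 + c • S) = 1 := by
    simp only [sub_mul, mul_add, one_mul, mul_one, smul_mul_assoc, mul_smul_comm, ← hRS]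
    module
  have h₂ : (1 + c • S) * (1 - c • R) = 1 := by
    simp only [add_mul, mul_sub, one_mul, mul_one, smul_mul_assoc, mul_smul_comm, ← hSR]
    module
  have hunit : IsUnit (1 - c • R) := ⟨⟨_, _, h₁, h₂⟩, rfl⟩
  rw [spectrum.notMem_iff, show algebraMap ℂ (H →L[ℂ] H) c⁻¹ - R = Units.mk0 c⁻¹ (inv_ne_zero hc) •
    (1 - c • R) by simp [Units.smul_def, smul_sub, smul_smul, hc, Algebra.algebraMap_eq_smul_one]]
  exact hunit.smul _

end Resolvent

section GraphResolvent

variable {H K : Type*} [NormedAddCommGroup H] [InnerProductSpace ℂ H] [CompleteSpace H]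
  [NormedAddCommGroup K] [InnerProductSpace ℂ K]
  (G : Submodule ℂ (WithLp 2 (H × K))) [CompleteSpace G]

/-- The adjoint of the first projection `G → H` of a graph `G ⊆ H ⊕ K`, where `G` carries the
graph norm. -/
def graphFstAdjoint : H →L[ℂ] G :=
  ContinuousLinearMap.adjoint ((WithLp.fstL 2 ℂ H K).comp G.subtypeL)

/-- The inverse `P P†` of `L + 1`, where `L` is the operator associated with the form `‖T u‖²`,
`G` is the graph of `T`, and `P : G → H` is the first projection. -/
def graphResolvent : H →L[ℂ] H :=
  ((WithLp.fstL 2 ℂ H K).comp G.subtypeL).comp (graphFstAdjoint G)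

theorem inner_graphFstAdjoint (p : G) (g : H) :
    inner ℂ p (graphFstAdjoint G g) = inner ℂ (p : WithLp 2 (H × K)).fst g :=
  ContinuousLinearMap.adjoint_inner_right _ p g

theorem isResolventAt_graphResolvent :
    IsResolventAt (formOperator {p : H × K | WithLp.toLp 2 p ∈ G}) (-1) (graphResolvent G) := by
  refine ⟨fun g => ⟨(graphFstAdjoint G g : WithLp 2 (H × K)).snd, (graphFstAdjoint G g).2,
    fun v z hvz => ?_⟩, fun u f ⟨w, hw, hf⟩ => ?_⟩
  · have h := inner_graphFstAdjoint G ⟨_, hvz⟩ g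
    rw [Submodule.coe_inner, WithLp.prod_inner_apply] at h
    rw [neg_one_smul, ← sub_eq_add_neg, inner_sub_right, eq_sub_iff_add_eq']
    exact h
  · have hadj : graphFstAdjoint G (f + u) = ⟨WithLp.toLp 2 (u, w), hw⟩ := by
      refine ext_inner_left ℂ fun p => ?_
      rw [inner_graphFstAdjoint, Submodule.coe_inner, WithLp.prod_inner_apply, inner_add_right,
        add_comm]
      exact congrArg _ (hf _ _ p.2).symm
    rw [neg_one_smul, sub_neg_eq_add, graphResolvent, ContinuousLinearMap.comp_apply, hadj]
    rfl

theorem graphResolvent_nonneg : 0 ≤ graphResolvent G :=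
  (ContinuousLinearMap.nonneg_iff_isPositive _).2
    (ContinuousLinearMap.isPositive_self_comp_adjoint _)

theorem sq_norm_fst_le_norm_graphResolvent_mul (p : G) :
    ‖(p : WithLp 2 (H × K)).fst‖ ^ 2 ≤
      ‖graphResolvent G‖ * (‖(p : WithLp 2 (H × K)).fst‖ ^ 2 +
        ‖(p : WithLp 2 (H × K)).snd‖ ^ 2) := by
  set P : G →L[ℂ] H := (WithLp.fstL 2 ℂ H K).comp G.subtypeL
  have hR : ‖graphResolvent G‖ = ‖P‖ * ‖P‖ := by
    have h := ContinuousLinearMap.norm_adjoint_comp_self (ContinuousLinearMap.adjoint P)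
    rwa [ContinuousLinearMap.adjoint_adjoint, LinearIsometryEquiv.norm_map] at h
  calc ‖P p‖ ^ 2 ≤ (‖P‖ * ‖p‖) ^ 2 := pow_le_pow_left₀ (norm_nonneg _) (P.le_opNorm p) 2
    _ = ‖graphResolvent G‖ * ‖(p : WithLp 2 (H × K))‖ ^ 2 := by rw [hR, Submodule.coe_norm]; ring
    _ = _ := by rw [WithLp.prod_norm_sq_eq_of_L2]

theorem inv_norm_graphResolvent_sub_one_mem_spectrumOf (h0 : graphResolvent G ≠ 0) :
    ((‖graphResolvent G‖⁻¹ - 1 : ℝ) : ℂ) ∈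
      spectrumOf (formOperator {p : H × K | WithLp.toLp 2 p ∈ G}) := by
  rintro ⟨S, hS⟩
  have hnorm : ‖graphResolvent G‖ ≠ 0 := norm_ne_zero_iff.2 h0
  have : Nontrivial (H →L[ℂ] H) := ⟨_, _, h0⟩
  have hmem : ((‖graphResolvent G‖ : ℝ) : ℂ) ∈ spectrum ℂ (graphResolvent G) :=
    spectrum.algebraMap_mem ℂ (CStarAlgebra.norm_mem_spectrum_of_nonneg (graphResolvent_nonneg G))
  refine (isResolventAt_graphResolvent G).inv_sub_notMem_spectrum hS ?_ (by simpa using hmem)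
  simpa [sub_eq_iff_eq_add] using hnorm

theorem bottomOfSpectrum_le_rayleighQuotient {u : H} {w : K} (hu : u ≠ 0)
    (huw : WithLp.toLp 2 (u, w) ∈ G) :
    bottomOfSpectrum (formOperator {p : H × K | WithLp.toLp 2 p ∈ G}) ≤
      (((‖w‖ / ‖u‖) ^ 2 : ℝ) : EReal) := by
  have hu' : 0 < ‖u‖ ^ 2 := by positivity
  have hle : ‖u‖ ^ 2 ≤ ‖graphResolvent G‖ * (‖u‖ ^ 2 + ‖w‖ ^ 2) :=
    sq_norm_fst_le_norm_graphResolvent_mul G ⟨_, huw⟩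
  have hpos : 0 < ‖graphResolvent G‖ :=
    pos_of_mul_pos_left (hu'.trans_le hle) (by positivity)
  refine iInf₂_le_of_le _ (inv_norm_graphResolvent_sub_one_mem_spectrumOf G
    (norm_pos_iff.1 hpos)) ?_
  rw [EReal.coe_le_coe_iff, div_pow, sub_le_iff_le_add, div_add_one hu'.ne',
    inv_le_comm₀ hpos (by positivity), inv_div, div_le_iff₀ (by positivity), add_comm (‖w‖ ^ 2)]
  exact hle

end GraphResolvent

section Closedness

/-- The continuous linear functional `u ↦ ∫ u g` on `L²(μ)`, for `g ∈ L²(μ)`. -/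
def l2Pairing {X : Type*} [MeasurableSpace X] {μ : Measure X} {g : X → ℂ} (hg : MemLp g 2 μ) :
    Lp ℂ 2 μ →L[ℂ] ℂ :=
  ((ContinuousLinearMap.mul ℂ ℂ).lpPairing μ 2 2).flip hg.toLp

theorem l2Pairing_apply {X : Type*} [MeasurableSpace X] {μ : Measure X} {g : X → ℂ}
    (hg : MemLp g 2 μ) (u : Lp ℂ 2 μ) : l2Pairing hg u = ∫ x, u x * g x ∂μ := by
  rw [l2Pairing, ContinuousLinearMap.flip_apply, ContinuousLinearMap.lpPairing_eq_integral]
  refine integral_congr_ae ?_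
  filter_upwards [hg.coeFn_toLp] with x hx
  rw [ContinuousLinearMap.mul_apply', hx]

theorem continuous_coord (j : Fin 3) : Continuous fun x : Space => x j :=
  PiLp.continuous_apply 2 _ j

variable (A : Space →ₗ[ℝ] Space) (Ω : Set Space)

theorem continuous_potential (j : Fin 3) : Continuous fun x : Space => A x j :=
  (continuous_coord j).comp A.continuous_of_finiteDimensional

variable (j : Fin 3) {φ : Space → ℂ}

theorem memLp_test (hφ : ContDiff ℝ ∞ φ) (hc : HasCompactSupport φ) :
    MemLp φ 2 (volume.restrict Ω) :=
  hφ.continuous.memLp_of_hasCompactSupport hc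

theorem memLp_fderiv_test (hφ : ContDiff ℝ ∞ φ) (hc : HasCompactSupport φ) :
    MemLp (fun x => fderiv ℝ φ x (stdVec j)) 2 (volume.restrict Ω) :=
  ((hφ.continuous_fderiv (by simp)).clm_apply continuous_const).memLp_of_hasCompactSupport
    (hc.fderiv_apply ℝ _)

theorem memLp_potential_mul_test (hφ : ContDiff ℝ ∞ φ) (hc : HasCompactSupport φ) :
    MemLp (fun x => ((A x j : ℝ) : ℂ) * φ x) 2 (volume.restrict Ω) :=
  ((Complex.continuous_ofReal.comp (continuous_potential A j)).mul
    hφ.continuous).memLp_of_hasCompactSupport hc.mul_left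

variable (hφ : ContDiff ℝ ∞ φ) (hc : HasCompactSupport φ)

/-- The functional on `L²(Ω) ⊕ L²(Ω)³` that tests the equation `∂ⱼ u = i (wⱼ + aⱼ u)` against
`φ`. -/
def magneticTestFunctional :
    WithLp 2 (L2 Ω × PiLp 2 (fun _ : Fin 3 => L2 Ω)) →L[ℂ] ℂ :=
  (l2Pairing (memLp_fderiv_test Ω j hφ hc) +
      Complex.I • l2Pairing (memLp_potential_mul_test A Ω j hφ hc)).comp
    (WithLp.fstL 2 ℂ (L2 Ω) (PiLp 2 (fun _ : Fin 3 => L2 Ω))) +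
  (Complex.I • l2Pairing (memLp_test Ω hφ hc)).comp
    ((PiLp.proj 2 (𝕜 := ℂ) (fun _ : Fin 3 => L2 Ω) j).comp
      (WithLp.sndL 2 ℂ (L2 Ω) (PiLp 2 (fun _ : Fin 3 => L2 Ω))))

theorem magneticTestFunctional_eq_zero_iff
    (p : WithLp 2 (L2 Ω × PiLp 2 (fun _ : Fin 3 => L2 Ω))) :
    magneticTestFunctional A Ω j hφ hc p = 0 ↔
      ∫ x in Ω, (p.fst : Space → ℂ) x * fderiv ℝ φ x (stdVec j) =
        -∫ x in Ω, (Complex.I * ((p.snd j : Space → ℂ) x +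
          ((A x j : ℝ) : ℂ) * (p.fst : Space → ℂ) x)) * φ x := by
  have hintA : Integrable (fun x => (p.fst : Space → ℂ) x * (((A x j : ℝ) : ℂ) * φ x))
      (volume.restrict Ω) := (Lp.memLp _).integrable_mul (memLp_potential_mul_test A Ω j hφ hc)
  have hintw : Integrable (fun x => (p.snd j : Space → ℂ) x * φ x) (volume.restrict Ω) :=
    (Lp.memLp _).integrable_mul (memLp_test Ω hφ hc)
  have hmul : ∫ x in Ω, (Complex.I * ((p.snd j : Space → ℂ) x +
        ((A x j : ℝ) : ℂ) * (p.fst : Space → ℂ) x)) * φ x =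
      Complex.I * (∫ x in Ω, (p.fst : Space → ℂ) x * (((A x j : ℝ) : ℂ) * φ x)) +
        Complex.I * ∫ x in Ω, (p.snd j : Space → ℂ) x * φ x := by
    rw [← mul_add, ← integral_add hintA hintw, ← integral_const_mul]
    congr 1 with x
    ring
  rw [hmul, eq_neg_iff_add_eq_zero, ← add_assoc]
  simp only [magneticTestFunctional, add_apply, ContinuousLinearMap.comp_apply, smul_apply,
    smul_eq_mul, l2Pairing_apply, WithLp.fstL_apply, WithLp.sndL_apply, PiLp.proj_apply]

/-- The graph of the magnetic gradient as a subspace of the Hilbert sum, written as an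
intersection of kernels of continuous functionals so that it is visibly closed. -/
def magneticGraph : Submodule ℂ (WithLp 2 (L2 Ω × PiLp 2 (fun _ : Fin 3 => L2 Ω))) :=
  ⨅ (j : Fin 3) (φ : Space → ℂ) (hφ : ContDiff ℝ ∞ φ) (hc : HasCompactSupport φ)
    (_ : tsupport φ ⊆ Ω), (magneticTestFunctional A Ω j hφ hc).ker

theorem toLp_mem_magneticGraph_iff (p : L2 Ω × PiLp 2 (fun _ : Fin 3 => L2 Ω)) :
    WithLp.toLp 2 p ∈ magneticGraph A Ω ↔ p ∈ magneticGradient A Ω := by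
  simp only [magneticGraph, Submodule.mem_iInf, LinearMap.mem_ker, ContinuousLinearMap.coe_coe,
    magneticTestFunctional_eq_zero_iff]
  rfl

theorem isClosed_magneticGraph :
    IsClosed (magneticGraph A Ω : Set (WithLp 2 (L2 Ω × PiLp 2 (fun _ : Fin 3 => L2 Ω)))) := by
  simp only [magneticGraph, Submodule.coe_iInf]
  exact isClosed_iInter fun j => isClosed_iInter fun φ => isClosed_iInter fun hφ =>
    isClosed_iInter fun hc => isClosed_iInter fun _ =>
      (magneticTestFunctional A Ω j hφ hc).isClosed_ker

variable {A Ω}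

theorem groundEnergy_le_rayleighQuotient {u : L2 Ω} {w : PiLp 2 (fun _ : Fin 3 => L2 Ω)}
    (hu : u ≠ 0) (huw : (u, w) ∈ magneticGradient A Ω) :
    groundEnergy A Ω ≤ (((‖w‖ / ‖u‖) ^ 2 : ℝ) : EReal) := by
  have : CompleteSpace (magneticGraph A Ω) := (isClosed_magneticGraph A Ω).completeSpace_coe
  simpa only [toLp_mem_magneticGraph_iff, Set.ofPred_mem_eq] using!
    bottomOfSpectrum_le_rayleighQuotient (magneticGraph A Ω) hu
      ((toLp_mem_magneticGraph_iff A Ω _).2 huw)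

end Closedness

/-! ### Integration over a thin wedge -/

section Wedge

/-- The open wedge `|x₂| < x₁ T` of slope `T`. -/
def openWedge (T : ℝ) : Set Space := {x | |x 1| < x 0 * T}

theorem isOpen_openWedge (T : ℝ) : IsOpen (openWedge T) :=
  isOpen_lt (continuous_coord 1).abs ((continuous_coord 0).mul continuous_const)

theorem openWedge_subset {T : ℝ} (hT : 0 < T) : openWedge T ⊆ {x | 0 < x 0} := fun x hx =>
  pos_of_mul_pos_left ((abs_nonneg (x 1)).trans_lt hx) hT.le

theorem wedge_eq {α : ℝ} (hα : α < Real.pi) :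
    wedge α = {x : Space | |x 1| ≤ x 0 * Real.tan (α / 2)} := by
  ext x
  simp only [wedge, Set.mem_ofPred_eq, hα, true_and, hα.ne, false_and, hα.not_gt, or_false]

theorem interior_wedge {α : ℝ} (h0 : 0 < α) (hα : α < Real.pi) :
    interior (wedge α) = openWedge (Real.tan (α / 2)) := by
  have hT : 0 < Real.tan (α / 2) :=
    Real.tan_pos_of_pos_of_lt_pi_div_two (by linarith) (by linarith)
  rw [wedge_eq hα]
  refine subset_antisymm (fun x hx => ?_)
    (interior_maximal (fun x hx => (le_of_lt (show |x 1| < _ from hx) :)) (isOpen_openWedge _))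
  -- The points `x - t e₁` with small `t > 0` still lie in the closed wedge.
  have hc : Tendsto (fun t : ℝ => x - t • stdVec 0) (𝓝[>] 0) (𝓝 x) := by
    have : Continuous fun t : ℝ => x - t • stdVec 0 := by fun_prop
    simpa using (this.tendsto 0).mono_left nhdsWithin_le_nhds
  obtain ⟨t, ht, ht0 : 0 < t⟩ :=
    ((hc.eventually (mem_interior_iff_mem_nhds.1 hx)).and self_mem_nhdsWithin).exists
  have ht' : |x 1| ≤ (x 0 - t) * Real.tan (α / 2) := by simpa [stdVec] using ht
  exact ht'.trans_lt (mul_lt_mul_of_pos_right (sub_lt_self _ ht0) hT)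

end Wedge

section Coordinates

/-- The splitting of Euclidean space as the product of the `j`-th coordinate axis and the
remaining coordinates. -/
def splitCoord {n : ℕ} (j : Fin (n + 1)) :
    EuclideanSpace ℝ (Fin (n + 1)) ≃ᵐ ℝ × (Fin n → ℝ) :=
  (MeasurableEquiv.toLp 2 (Fin (n + 1) → ℝ)).symm.trans
    (MeasurableEquiv.piFinSuccAbove (fun _ => ℝ) j)

theorem measurePreserving_splitCoord {n : ℕ} (j : Fin (n + 1)) :
    MeasurePreserving (splitCoord j) :=
  (volume_preserving_piFinSuccAbove (fun _ => ℝ) j).comp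
    (EuclideanSpace.volume_preserving_symm_measurableEquiv_toLp _)

variable {β κ : ℝ}

theorem map_volume_scaledCoords (hβ : 0 < β) (hκ : 0 < κ) :
    (volume : Measure Space).map (fun x => ((β * x 0, κ * x 2), x 1)) =
      ENNReal.ofReal (β⁻¹ * κ⁻¹) • volume := by
  have hcoord : MeasurePreserving (fun x : Space => ((x 0, x 2), x 1)) :=
    ((volume_preserving_finTwoArrow ℝ).prod (.id volume)).comp
      (Measure.measurePreserving_swap.comp (measurePreserving_splitCoord 1))
  have hscale : (volume : Measure ((ℝ × ℝ) × ℝ)).map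
      (Prod.map (Prod.map (β * ·) (κ * ·)) id) = ENNReal.ofReal (β⁻¹ * κ⁻¹) • volume := by
    rw [Measure.volume_eq_prod, Measure.volume_eq_prod, ← Measure.map_prod_map _ _
      (by fun_prop) measurable_id, ← Measure.map_prod_map _ _ (by fun_prop) (by fun_prop),
      Real.map_volume_mul_left hβ.ne', Real.map_volume_mul_left hκ.ne', Measure.map_id,
      Measure.prod_smul_left, Measure.prod_smul_right, smul_smul, Measure.prod_smul_left,
      abs_of_pos (inv_pos.2 hβ), abs_of_pos (inv_pos.2 hκ), ENNReal.ofReal_mul (by positivity)]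
  rw [← hscale, ← hcoord.map_eq, Measure.map_map (by fun_prop) hcoord.measurable]
  rfl

theorem radialMeasure_eq_withDensity :
    radialMeasure = volume.withDensity fun r => ENNReal.ofReal r := by
  rw [radialMeasure, ← withDensity_indicator measurableSet_Ioi]
  congr 1
  refine Set.indicator_eq_self.2 fun r hr => ?_
  simpa using hr

instance : SigmaFinite radialMeasure :=
  SigmaFinite.withDensity_ofReal _

theorem map_restrict_openWedge {T : ℝ} (hβ : 0 < β) (hκ : 0 < κ) (hT : 0 < T) :
    (volume.restrict (openWedge T)).map (fun x => (β * x 0, κ * x 2)) =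
      ENNReal.ofReal (2 * T / (β ^ 2 * κ)) • radialMeasure.prod volume := by
  have hmeas : Measurable fun x : Space => ((β * x 0, κ * x 2), x 1) := by fun_prop
  have hmeas' : Measurable fun x : Space => (β * x 0, κ * x 2) := by fun_prop
  rw [radialMeasure_eq_withDensity, prod_withDensity_left (by fun_prop)]
  ext S hS
  have hpre : (fun x : Space => (β * x 0, κ * x 2)) ⁻¹' S ∩ openWedge T =
      (fun x : Space => ((β * x 0, κ * x 2), x 1)) ⁻¹'
        regionBetween (fun q => -(q.1 / β * T)) (fun q => q.1 / β * T) S := by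
    ext x
    simp [openWedge, regionBetween, abs_lt, hβ.ne']
  have hregion : MeasurableSet
      (regionBetween (fun q : ℝ × ℝ => -(q.1 / β * T)) (fun q => q.1 / β * T) S) :=
    measurableSet_regionBetween (by fun_prop) (by fun_prop) hS
  rw [Measure.map_apply hmeas' hS, Measure.restrict_apply (hmeas' hS), hpre,
    ← Measure.map_apply hmeas hregion, map_volume_scaledCoords hβ hκ, Measure.smul_apply,
    Measure.smul_apply, withDensity_apply _ hS, Measure.volume_eq_prod (ℝ × ℝ) ℝ,
    volume_regionBetween_eq_lintegral (by fun_prop) (by fun_prop) hS, smul_eq_mul, smul_eq_mul,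
    ← lintegral_const_mul _ (by fun_prop), ← lintegral_const_mul _ (by fun_prop)]
  congr 1 with q
  rw [← ENNReal.ofReal_mul (by positivity), ← ENNReal.ofReal_mul (by positivity)]
  congr 1
  simp only [Pi.sub_apply]
  field_simp
  ring

end Coordinates

section TensorProduct

variable {X Y : Type*} [MeasurableSpace X] [MeasurableSpace Y] {μ : Measure X} {ν : Measure Y}
  [SFinite ν] {p : ℝ≥0∞} {f : X → ℂ} {g : Y → ℂ}

theorem eLpNorm_prod_mul (hp : p ≠ 0) (hp' : p ≠ ⊤) (hf : AEStronglyMeasurable f μ)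
    (hg : AEStronglyMeasurable g ν) :
    eLpNorm (fun z : X × Y => f z.1 * g z.2) p (μ.prod ν) = eLpNorm f p μ * eLpNorm g p ν := by
  simp only [eLpNorm_eq_lintegral_rpow_enorm_toReal hp hp', enorm_mul,
    ENNReal.mul_rpow_of_nonneg _ _ ENNReal.toReal_nonneg]
  rw [lintegral_prod_mul (f := fun x => ‖f x‖ₑ ^ p.toReal) (g := fun y => ‖g y‖ₑ ^ p.toReal)
    (by fun_prop) (by fun_prop), ENNReal.mul_rpow_of_nonneg _ _ (by positivity)]

end TensorProduct

/-! ### Calculus of weak derivatives -/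

section WeakDerivative

theorem setIntegral_mul_eq_integral {X : Type*} [TopologicalSpace X] [MeasureSpace X] {Ω : Set X}
    {u g : X → ℂ} (hg : tsupport g ⊆ Ω) : ∫ x in Ω, u x * g x = ∫ x, u x * g x :=
  setIntegral_eq_integral_of_forall_compl_eq_zero fun x hx => by
    rw [image_eq_zero_of_notMem_tsupport (mt (@hg x) hx), mul_zero]

theorem integrable_mul_of_tsupport_subset {X : Type*} [TopologicalSpace X] [T2Space X]
    [MeasureSpace X] [OpensMeasurableSpace X] {Ω : Set X} {u g : X → ℂ}
    (hu : LocallyIntegrableOn u Ω) (hg : Continuous g) (hc : HasCompactSupport g)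
    (hs : tsupport g ⊆ Ω) : Integrable fun x => u x * g x :=
  (integrableOn_iff_integrable_of_support_subset
    ((Function.support_mul_subset_right u g).trans (subset_tsupport g))).1
    ((hu.integrableOn_compact_subset hs hc).mul_continuousOn hg.continuousOn hc)

theorem continuous_fderiv_apply {E : Type*} [NormedAddCommGroup E] [NormedSpace ℝ E] {ψ : E → ℂ}
    (hψ : ContDiff ℝ ∞ ψ) (e : E) :
    Continuous fun x => fderiv ℝ ψ x e :=
  (hψ.continuous_fderiv (by simp)).clm_apply continuous_const

variable {E : Type*} [NormedAddCommGroup E] [NormedSpace ℝ E] [MeasureSpace E]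
  {Ω : Set E} {e : E} {u v u' v' ψ : E → ℂ}

theorem hasWeakDeriv_iff_integral : HasWeakDeriv Ω e u v ↔
    ∀ φ : E → ℂ, ContDiff ℝ ∞ φ → HasCompactSupport φ → tsupport φ ⊆ Ω →
      ∫ x, u x * fderiv ℝ φ x e = -∫ x, v x * φ x := by
  refine forall₄_congr fun φ _ _ hs => ?_
  rw [setIntegral_mul_eq_integral ((tsupport_fderiv_apply_subset ℝ e).trans hs),
    setIntegral_mul_eq_integral hs]

theorem HasWeakDeriv.mono {Ω' : Set E} (h : HasWeakDeriv Ω e u v) (hΩ : Ω' ⊆ Ω) :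
    HasWeakDeriv Ω' e u v :=
  hasWeakDeriv_iff_integral.2 fun φ hφ hc hs =>
    hasWeakDeriv_iff_integral.1 h φ hφ hc (hs.trans hΩ)

theorem HasWeakDeriv.congr_ae (h : HasWeakDeriv Ω e u v)
    (hu : u =ᵐ[volume.restrict Ω] u') (hv : v =ᵐ[volume.restrict Ω] v') :
    HasWeakDeriv Ω e u' v' := fun φ hφ hc hs => by
  have hu' : ∫ x in Ω, u x * fderiv ℝ φ x e = ∫ x in Ω, u' x * fderiv ℝ φ x e :=
    integral_congr_ae (hu.mul .rfl)
  have hv' : ∫ x in Ω, v x * φ x = ∫ x in Ω, v' x * φ x := integral_congr_ae (hv.mul .rfl)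
  rw [← hu', ← hv']
  exact h φ hφ hc hs

theorem HasWeakDeriv.mul_contDiff [OpensMeasurableSpace E] (h : HasWeakDeriv Ω e u v)
    (hu : LocallyIntegrableOn u Ω) (hv : LocallyIntegrableOn v Ω) (hψ : ContDiff ℝ ∞ ψ) :
    HasWeakDeriv Ω e (fun x => u x * ψ x) fun x => v x * ψ x + u x * fderiv ℝ ψ x e := by
  rw [hasWeakDeriv_iff_integral] at h ⊢
  intro φ hφ hc hs
  have hderiv : ∀ x, fderiv ℝ (fun x => ψ x * φ x) x e =
      ψ x * fderiv ℝ φ x e + fderiv ℝ ψ x e * φ x := fun x => by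
    rw [fderiv_fun_mul (hψ.differentiable (by simp) x) (hφ.differentiable (by simp) x)]
    simp [mul_comm]
  have hsψ : tsupport (fun x => ψ x * φ x) ⊆ Ω := (tsupport_mul_subset_right).trans hs
  have h₁ : Integrable fun x => u x * (ψ x * fderiv ℝ φ x e) :=
    integrable_mul_of_tsupport_subset hu (hψ.continuous.mul (continuous_fderiv_apply hφ e))
      (hc.fderiv_apply ℝ e).mul_left
      (tsupport_mul_subset_right.trans ((tsupport_fderiv_apply_subset ℝ e).trans hs))
  have h₂ : Integrable fun x => u x * (fderiv ℝ ψ x e * φ x) :=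
    integrable_mul_of_tsupport_subset hu ((continuous_fderiv_apply hψ e).mul hφ.continuous)
      hc.mul_left (tsupport_mul_subset_right.trans hs)
  have h₃ : Integrable fun x => v x * (ψ x * φ x) :=
    integrable_mul_of_tsupport_subset hv (hψ.continuous.mul hφ.continuous) hc.mul_left hsψ
  have key := h _ (hψ.mul hφ) hc.mul_left hsψ
  simp only [hderiv, mul_add] at key
  rw [integral_add h₁ h₂] at key
  simp only [add_mul, mul_assoc]
  rw [integral_add h₃ h₂, neg_add, ← key]
  ring

end WeakDerivative

section Line

variable {V V' : ℝ → ℂ} {s : Set ℝ}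

theorem hasWeakDeriv_const (s : Set ℝ) (c : ℂ) : HasWeakDeriv s 1 (fun _ => c) fun _ => 0 := by
  refine hasWeakDeriv_iff_integral.2 fun φ hφ hc _ => ?_
  have hint : ∫ r, fderiv ℝ φ r 1 = 0 :=
    integral_eq_zero_of_hasDerivAt_of_integrable
      (fun r => (hφ.differentiable (by simp) r).hasFDerivAt.hasDerivAt)
      ((continuous_fderiv_apply hφ 1).integrable_of_hasCompactSupport (hc.fderiv_apply ℝ 1))
      (hφ.continuous.integrable_of_hasCompactSupport hc)
  simp only [integral_const_mul, hint, zero_mul, mul_zero, integral_zero, neg_zero]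

theorem integral_comp_mul_add (β c : ℝ) (f : ℝ → ℂ) :
    ∫ r, f (β * r + c) = |β⁻¹| • ∫ r, f r := by
  rw [Measure.integral_comp_mul_left (fun r => f (r + c)), integral_add_right_eq_self f]

theorem HasWeakDeriv.comp_mul_add (h : HasWeakDeriv s 1 V V') {β : ℝ} (hβ : β ≠ 0) (c : ℝ) :
    HasWeakDeriv ((fun r => β * r + c) ⁻¹' s) 1 (fun r => V (β * r + c))
      fun r => β * V' (β * r + c) := by
  rw [hasWeakDeriv_iff_integral] at h ⊢
  intro φ hφ hc hs
  let a : ℝ ≃ₜ ℝ := (Homeomorph.mulLeft₀ β hβ).trans (Homeomorph.addRight c)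
  have ha : ∀ r, a.symm r = β⁻¹ * (r - c) := fun r => by
    rw [Homeomorph.symm_apply_eq]
    simp [a, hβ]
  have hsupp : tsupport (fun r => φ (β⁻¹ * (r - c))) ⊆ s := by
    simp only [← ha]
    refine (tsupport_comp_subset_preimage φ a.symm.continuous).trans fun r hr => ?_
    simpa only [a.apply_symm_apply] using show a (a.symm r) ∈ s from hs hr
  have hcs : HasCompactSupport fun r => φ (β⁻¹ * (r - c)) := by
    simpa only [Function.comp_def, ha] using hc.comp_homeomorph a.symm
  have hderiv : ∀ r, fderiv ℝ (fun r => φ (β⁻¹ * (r - c))) r 1 =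
      (β⁻¹ : ℝ) • fderiv ℝ φ (β⁻¹ * (r - c)) 1 := fun r => by
    rw [fderiv_apply_one_eq_deriv, fderiv_apply_one_eq_deriv,
      deriv_comp_sub_const (fun r => φ (β⁻¹ * r)) c, deriv_comp_mul_left]
  have key := h (fun r => φ (β⁻¹ * (r - c))) (hφ.comp (by fun_prop)) hcs hsupp
  simp only [hderiv, mul_smul_comm, integral_smul] at key
  have hinv : ∀ r, β⁻¹ * (β * r + c - c) = r := fun r => by
    rw [add_sub_cancel_right, inv_mul_cancel_left₀ hβ]
  have h₁ := integral_comp_mul_add β c fun r => V r * fderiv ℝ φ (β⁻¹ * (r - c)) 1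
  have h₂ := integral_comp_mul_add β c fun r => V' r * φ (β⁻¹ * (r - c))
  simp only [hinv] at h₁ h₂
  simp only [h₁, mul_assoc, integral_const_mul, h₂]
  rw [inv_smul_eq_iff₀ hβ] at key
  rw [key, ← Complex.real_smul, smul_neg, smul_neg, smul_comm]

end Line

section Slices

variable {n : ℕ} {j : Fin (n + 1)} {Ω : Set (EuclideanSpace ℝ (Fin (n + 1)))}
  {u v : EuclideanSpace ℝ (Fin (n + 1)) → ℂ}

theorem splitCoord_symm_apply (r : ℝ) (y : Fin n → ℝ) :
    (splitCoord j).symm (r, y) =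
      (splitCoord j).symm (0, y) + r • EuclideanSpace.single j (1 : ℝ) := by
  have hcoord : ∀ (r : ℝ) (i : Fin (n + 1)),
      (splitCoord j).symm (r, y) i = j.insertNth (α := fun _ => ℝ) r y i := fun _ _ => rfl
  ext i
  rw [PiLp.add_apply, PiLp.smul_apply, hcoord, hcoord]
  obtain rfl | ⟨i, rfl⟩ := j.eq_self_or_eq_succAbove i
  · rw [Fin.insertNth_apply_same, Fin.insertNth_apply_same, PiLp.single_apply, if_pos rfl,
      smul_eq_mul, mul_one, zero_add]
  · rw [Fin.insertNth_apply_succAbove, Fin.insertNth_apply_succAbove, PiLp.single_apply,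
      if_neg (j.succAbove_ne i), smul_zero, add_zero]

theorem integral_eq_integral_slices (j : Fin (n + 1)) {f : EuclideanSpace ℝ (Fin (n + 1)) → ℂ}
    (hf : Integrable f) : ∫ x, f x =
      ∫ y, ∫ r : ℝ, f ((splitCoord j).symm (0, y) + r • EuclideanSpace.single j (1 : ℝ)) := by
  have hj := (measurePreserving_splitCoord j).symm
  rw [← hj.integral_comp', Measure.volume_eq_prod, integral_prod_symm]
  · congr 1 with y
    congr 1 with r
    rw [splitCoord_symm_apply]
  · exact (hj.integrable_comp_emb (MeasurableEquiv.measurableEmbedding _)).2 hf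

theorem hasCompactSupport_comp_line {φ : EuclideanSpace ℝ (Fin (n + 1)) → ℂ}
    (hc : HasCompactSupport φ) (a : EuclideanSpace ℝ (Fin (n + 1))) :
    HasCompactSupport fun r : ℝ => φ (a + r • EuclideanSpace.single j (1 : ℝ)) := by
  refine .intro (hc.image (f := fun x => x j - a j) (by fun_prop)) fun r hr => ?_
  refine image_eq_zero_of_notMem_tsupport fun hmem => hr ⟨_, hmem, ?_⟩
  simp

theorem HasWeakDeriv.of_slices (hu : LocallyIntegrableOn u Ω) (hv : LocallyIntegrableOn v Ω)
    (h : ∀ a, HasWeakDeriv ((fun r : ℝ => a + r • EuclideanSpace.single j (1 : ℝ)) ⁻¹' Ω) 1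
      (fun r => u (a + r • EuclideanSpace.single j (1 : ℝ)))
      fun r => v (a + r • EuclideanSpace.single j (1 : ℝ))) :
    HasWeakDeriv Ω (EuclideanSpace.single j (1 : ℝ)) u v := by
  simp only [hasWeakDeriv_iff_integral] at h ⊢
  intro φ hφ hc hs
  have hdφ := integrable_mul_of_tsupport_subset hu
    (continuous_fderiv_apply hφ (EuclideanSpace.single j 1)) (hc.fderiv_apply ℝ _)
      ((tsupport_fderiv_apply_subset ℝ _).trans hs)
  rw [integral_eq_integral_slices j hdφ, integral_eq_integral_slices j
    (integrable_mul_of_tsupport_subset hv hφ.continuous hc hs), ← integral_neg]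
  congr 1 with y
  generalize (splitCoord j).symm (0, y) = a
  specialize h a
  revert h
  generalize he : EuclideanSpace.single j (1 : ℝ) = e
  intro h
  have hline : ContDiff ℝ ∞ fun r : ℝ => a + r • e := by fun_prop
  have hderiv (r : ℝ) : fderiv ℝ (fun r => φ (a + r • e)) r 1 = fderiv ℝ φ (a + r • e) e := by
    have haff : HasDerivAt (fun r : ℝ => a + r • e) e r := by
      simpa using ((hasDerivAt_id r).smul_const e).const_add a
    rw [fderiv_apply_one_eq_deriv]
    exact ((hφ.differentiable (by simp) _).hasFDerivAt.comp_hasDerivAt r haff).deriv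
  simpa only [hderiv] using h (fun r => φ (a + r • e)) (hφ.comp hline)
    (he ▸ hasCompactSupport_comp_line hc a)
    ((tsupport_comp_subset_preimage φ hline.continuous).trans (Set.preimage_mono hs))

end Slices

section Coordinate

variable {n : ℕ} {i j : Fin (n + 1)} {Ω : Set (EuclideanSpace ℝ (Fin (n + 1)))} {V V' : ℝ → ℂ}

theorem HasWeakDeriv.comp_coord {s : Set ℝ} (h : HasWeakDeriv s 1 V V') {β : ℝ} (hβ : β ≠ 0)
    (hΩ : ∀ x ∈ Ω, β * x i ∈ s) (hV : LocallyIntegrableOn (fun x => V (β * x i)) Ω)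
    (hV' : LocallyIntegrableOn (fun x => V' (β * x i)) Ω) :
    HasWeakDeriv Ω (EuclideanSpace.single j (1 : ℝ)) (fun x => V (β * x i))
      fun x => ((if i = j then β else 0 : ℝ) : ℂ) * V' (β * x i) := by
  refine .of_slices hV (hV'.smul ((if i = j then β else 0 : ℝ) : ℂ)) fun a => ?_
  by_cases hij : i = j
  · subst hij
    simpa [mul_add, add_comm] using
      (h.comp_mul_add hβ (β * a i)).mono (by
        intro r hr
        simpa [mul_add, add_comm] using hΩ _ hr)
  · simpa [hij] using hasWeakDeriv_const _ _

end Coordinate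

/-! ### The trial function and its energy -/

section TrialFunction

/-- The trial function `exp(iθ) f(β x₁) g(κ x₃)` on a wedge: a radial profile `f` in the direction
of the bisecting half-plane, a cut-off `g` along the edge, and a gauge phase `θ`. -/
def gaugedProduct (θ : Space → ℝ) (β κ : ℝ) (f g : ℝ → ℂ) (x : Space) : ℂ :=
  Complex.exp (Complex.I * θ x) * (f (β * x 0) * g (κ * x 2))

variable {θ : Space → ℝ} {β κ T : ℝ} {f g : ℝ → ℂ}

theorem norm_gaugedProduct (x : Space) :
    ‖gaugedProduct θ β κ f g x‖ = ‖f (β * x 0) * g (κ * x 2)‖ := by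
  rw [gaugedProduct, norm_mul, mul_comm Complex.I, Complex.norm_exp_ofReal_mul_I, one_mul]

theorem aestronglyMeasurable_map_openWedge (hβ : 0 < β) (hκ : 0 < κ) (hT : 0 < T)
    (hf : AEStronglyMeasurable f radialMeasure) (hg : AEStronglyMeasurable g volume) :
    AEStronglyMeasurable (fun z : ℝ × ℝ => f z.1 * g z.2)
      ((volume.restrict (openWedge T)).map fun x => (β * x 0, κ * x 2)) := by
  rw [map_restrict_openWedge hβ hκ hT]
  exact (hf.comp_fst.mul hg.comp_snd).smul_measure _

theorem eLpNorm_gaugedProduct (hβ : 0 < β) (hκ : 0 < κ) (hT : 0 < T)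
    (hf : AEStronglyMeasurable f radialMeasure) (hg : AEStronglyMeasurable g volume) :
    eLpNorm (gaugedProduct θ β κ f g) 2 (volume.restrict (openWedge T)) =
      ENNReal.ofReal √(2 * T / (β ^ 2 * κ)) * (eLpNorm f 2 radialMeasure * eLpNorm g 2 volume) := by
  have hmap := eLpNorm_map_measure (p := 2) (aestronglyMeasurable_map_openWedge hβ hκ hT hf hg)
    (by fun_prop)
  rw [map_restrict_openWedge hβ hκ hT, eLpNorm_smul_measure_of_ne_top (by simp),
    eLpNorm_prod_mul (by simp) (by simp) hf hg] at hmap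
  rw [eLpNorm_congr_norm_ae (ae_of_all _ norm_gaugedProduct), ← Function.comp_def
    (fun z : ℝ × ℝ => f z.1 * g z.2) (fun x : Space => (β * x 0, κ * x 2)), ← hmap, smul_eq_mul,
    Real.sqrt_eq_rpow, ← ENNReal.ofReal_rpow_of_nonneg (by positivity) (by positivity)]
  simp

theorem memLp_gaugedProduct (hβ : 0 < β) (hκ : 0 < κ) (hT : 0 < T) (hθ : Continuous θ)
    (hf : MemLp f 2 radialMeasure) (hg : MemLp g 2 volume) :
    MemLp (gaugedProduct θ β κ f g) 2 (volume.restrict (openWedge T)) := by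
  refine ⟨.mul (by fun_prop) ?_, ?_⟩
  · exact (aestronglyMeasurable_map_openWedge hβ hκ hT hf.1 hg.1).comp_measurable (by fun_prop)
  · rw [eLpNorm_gaugedProduct hβ hκ hT hf.1 hg.1]
    exact ENNReal.mul_lt_top ENNReal.ofReal_lt_top (ENNReal.mul_lt_top hf.2 hg.2)

theorem lpNorm_gaugedProduct (hβ : 0 < β) (hκ : 0 < κ) (hT : 0 < T) (hθ : Continuous θ)
    (hf : MemLp f 2 radialMeasure) (hg : MemLp g 2 volume) :
    lpNorm (gaugedProduct θ β κ f g) 2 (volume.restrict (openWedge T)) =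
      √(2 * T / (β ^ 2 * κ)) * (lpNorm f 2 radialMeasure * lpNorm g 2 volume) := by
  rw [← toReal_eLpNorm (memLp_gaugedProduct hβ hκ hT hθ hf hg).1, ← toReal_eLpNorm hf.1,
    ← toReal_eLpNorm hg.1, eLpNorm_gaugedProduct hβ hκ hT hf.1 hg.1, ENNReal.toReal_mul,
    ENNReal.toReal_mul, ENNReal.toReal_ofReal (Real.sqrt_nonneg _)]

theorem locallyIntegrableOn_comp_coord (hβ : 0 < β) (hT : 0 < T) (hf : MemLp f 2 radialMeasure) :
    LocallyIntegrableOn (fun x : Space => f (β * x 0)) (openWedge T) := fun x hx => by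
  let s : Set ℝ := Metric.ball (x 2) 1
  have hs : MemLp (s.indicator fun _ => (1 : ℂ)) 2 volume :=
    memLp_indicator_const 2 measurableSet_ball 1 (.inr measure_ball_lt_top.ne)
  have hU : IsOpen {y : Space | y 2 ∈ s} := Metric.isOpen_ball.preimage (continuous_coord 2)
  have hprod := memLp_gaugedProduct (θ := fun _ => 0) hβ one_pos hT continuous_const hf hs
  obtain ⟨t, ht, hint⟩ := locallyIntegrableOn_of_locallyIntegrable_restrict
    (hprod.locallyIntegrable one_le_two) x hx
  refine ⟨{y | y 2 ∈ s} ∩ t, inter_mem (mem_nhdsWithin_of_mem_nhds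
    (hU.mem_nhds (Metric.mem_ball_self one_pos))) ht, ?_⟩
  refine (hint.mono_set Set.inter_subset_right).congr_fun_ae ?_
  filter_upwards [ae_mono (Measure.restrict_mono Set.inter_subset_left le_rfl)
    (ae_restrict_mem hU.measurableSet)] with y (hy : y 2 ∈ s)
  simp [gaugedProduct, Set.indicator_of_mem hy]

theorem fderiv_gauge_mul_comp_coord (hθ : ContDiff ℝ ∞ θ) (hg : ContDiff ℝ ∞ g) (x : Space)
    (j : Fin 3) :
    fderiv ℝ (fun x : Space => Complex.exp (Complex.I * θ x) * g (κ * x 2)) x (stdVec j) =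
      Complex.exp (Complex.I * θ x) * (Complex.I * fderiv ℝ θ x (stdVec j) * g (κ * x 2) +
        ((if 2 = j then κ else 0 : ℝ) : ℂ) * deriv g (κ * x 2)) := by
  have hθx := (Complex.ofRealCLM.hasFDerivAt.comp x
    (hθ.differentiable (by simp) x).hasFDerivAt).const_mul Complex.I
  have hgx : HasFDerivAt (fun x : Space => g (κ * x 2)) _ x :=
    HasFDerivAt.comp (f := fun x : Space => κ * x 2) x
      (hg.differentiable (by simp) (κ * x 2)).hasFDerivAt
      ((EuclideanSpace.proj 2 : Space →L[ℝ] ℝ).hasFDerivAt.const_mul κ)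
  have hmul : HasFDerivAt (fun x : Space => Complex.exp (Complex.I * θ x) * g (κ * x 2)) _ x :=
    hθx.cexp.mul hgx
  rw [hmul.fderiv]
  by_cases hj : 2 = j <;> simp [stdVec, hj] <;> ring

theorem hasWeakDeriv_gaugedProduct {f' : ℝ → ℂ} (hβ : 0 < β) (hT : 0 < T)
    (hf : MemLp f 2 radialMeasure) (hf' : MemLp f' 2 radialMeasure)
    (hff' : HasWeakDeriv (Set.Ioi 0) 1 f f') (hθ : ContDiff ℝ ∞ θ) (hg : ContDiff ℝ ∞ g)
    (j : Fin 3) :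
    HasWeakDeriv (openWedge T) (stdVec j) (gaugedProduct θ β κ f g) fun x =>
      ((if 0 = j then β else 0 : ℝ) : ℂ) * gaugedProduct θ β κ f' g x +
      ((if 2 = j then κ else 0 : ℝ) : ℂ) * gaugedProduct θ β κ f (deriv g) x +
        Complex.I * fderiv ℝ θ x (stdVec j) * gaugedProduct θ β κ f g x := by
  have hV := locallyIntegrableOn_comp_coord hβ hT hf
  have hV' := locallyIntegrableOn_comp_coord hβ hT hf'
  have hψ : ContDiff ℝ ∞ fun x : Space => Complex.exp (Complex.I * θ x) * g (κ * x 2) :=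
    (contDiff_const.mul (Complex.ofRealCLM.contDiff.comp hθ)).cexp.mul (hg.comp (by fun_prop))
  have hcoord : HasWeakDeriv (openWedge T) (stdVec j) _ _ :=
    hff'.comp_coord hβ.ne' (fun x hx => mul_pos hβ (openWedge_subset hT hx)) hV hV'
  have hprod := hcoord.mul_contDiff hV (hV'.smul ((if 0 = j then β else 0 : ℝ) : ℂ)) hψ
  refine hprod.congr_ae (ae_of_all _ fun x => ?_) (ae_of_all _ fun x => ?_)
  · simp only [gaugedProduct]
    ring
  · simp only [gaugedProduct, fderiv_gauge_mul_comp_coord hθ hg]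
    ring

end TrialFunction

section Gauge

theorem sum_smul_stdVec (x : Space) : ∑ i, x i • stdVec i = x := by
  simpa [stdVec] using (EuclideanSpace.basisFun (Fin 3) ℝ).sum_repr x

theorem curl_sub (A A' : Space →ₗ[ℝ] Space) : curl (A - A') = curl A - curl A' := by
  ext j
  fin_cases j <;> simp [curl] <;> ring

theorem inner_stdVec_right (x : Space) (j : Fin 3) : inner ℝ x (stdVec j) = x j := by
  simp [stdVec, EuclideanSpace.inner_single_right]

theorem isSymmetric_of_curl_eq_zero {L : Space →ₗ[ℝ] Space} (hL : curl L = 0) :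
    L.IsSymmetric := by
  have hentry (i j : Fin 3) : L (stdVec i) j = L (stdVec j) i := by
    have h0 : L (stdVec 1) 2 - L (stdVec 2) 1 = 0 := congrArg (· 0) hL
    have h1 : L (stdVec 2) 0 - L (stdVec 0) 2 = 0 := congrArg (· 1) hL
    have h2 : L (stdVec 0) 1 - L (stdVec 1) 0 = 0 := congrArg (· 2) hL
    fin_cases i <;> fin_cases j <;>
      simp only [Fin.zero_eta, Fin.mk_one, Fin.reduceFinMk] <;> linarith
  intro x y
  rw [← sum_smul_stdVec x, ← sum_smul_stdVec y]
  simp_rw [map_sum, map_smul, sum_inner, inner_sum, real_inner_smul_left, real_inner_smul_right,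
    inner_stdVec_right, real_inner_comm (L _), inner_stdVec_right, hentry]

theorem exists_gauge {A A' : Space →ₗ[ℝ] Space} (h : curl A = curl A') :
    ∃ θ : Space → ℝ, ContDiff ℝ ∞ θ ∧ ∀ x j, fderiv ℝ θ x (stdVec j) = A x j - A' x j := by
  let L : Space →L[ℝ] Space := (A - A').toContinuousLinearMap
  have hcurl : curl (A - A') = 0 := by rw [curl_sub, h, sub_self]
  have hL : (L : Space →ₗ[ℝ] Space).IsSymmetric := isSymmetric_of_curl_eq_zero hcurl
  have hθ : ContDiff ℝ ∞ fun x => (1 / 2 : ℝ) * L.reApplyInnerSelf x :=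
    contDiff_const.mul (L.contDiff.inner ℝ contDiff_id)
  refine ⟨_, hθ, fun x j => ?_⟩
  rw [((hL.hasStrictFDerivAt_reApplyInnerSelf x).hasFDerivAt.const_mul (1 / 2)).fderiv]
  simp [inner_stdVec_right, L]

/-- The potential `(-b₃ x₂, 0, b₁ x₂ - b₂ x₁)` of the constant field `B`. On a thin wedge, where
`x₂` is small, only its term `-b₂ x₁` matters. -/
def axialPotential (B : Space) : Space →ₗ[ℝ] Space where
  toFun x := !₂[-(B 2 * x 1), 0, B 0 * x 1 - B 1 * x 0]
  map_add' x y := by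
    ext j
    fin_cases j <;> simp <;> ring
  map_smul' c x := by
    ext j
    fin_cases j <;> simp <;> ring

theorem curl_axialPotential (B : Space) : curl (axialPotential B) = B := by
  ext j
  fin_cases j <;> simp [curl, axialPotential, stdVec]

theorem exists_gaugePhase {A : Space →ₗ[ℝ] Space} {B : Space} (hA : curl A = B) (s : ℝ) :
    ∃ θ : Space → ℝ, ContDiff ℝ ∞ θ ∧ ∀ x j, fderiv ℝ θ x (stdVec j) =
      A x j - axialPotential B x j - if 2 = j then s else 0 := by
  obtain ⟨θ, hθ, hθA⟩ := exists_gauge (hA.trans (curl_axialPotential B).symm)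
  have hx : ContDiff ℝ ∞ fun x : Space => s * x 2 := by fun_prop
  refine ⟨fun x => θ x - s * x 2, hθ.sub hx, fun x j => ?_⟩
  have hderiv : HasFDerivAt (fun x : Space => s * x 2) _ x :=
    (EuclideanSpace.proj 2 : Space →L[ℝ] ℝ).hasFDerivAt.const_mul s
  rw [fderiv_fun_sub (hθ.differentiable (by simp) x) (hx.differentiable (by simp) x), sub_apply,
    hθA, hderiv.fderiv]
  simp [stdVec]

end Gauge

section EnergyOfTrialFunction

theorem lpNorm_le_mul_lpNorm_of_ae_le_mul {X E F : Type*} [MeasurableSpace X] {μ : Measure X}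
    [NormedAddCommGroup E] [NormedAddCommGroup F] {p : ℝ≥0∞} {f : X → E} {g : X → F} {c : ℝ}
    (hc : 0 ≤ c) (hf : AEStronglyMeasurable f μ) (hg : MemLp g p μ)
    (h : ∀ᵐ x ∂μ, ‖f x‖ ≤ c * ‖g x‖) : lpNorm f p μ ≤ c * lpNorm g p μ := by
  rw [← toReal_eLpNorm hf, ← toReal_eLpNorm hg.1, ← ENNReal.toReal_ofReal hc, ← ENNReal.toReal_mul]
  exact ENNReal.toReal_mono (ENNReal.mul_ne_top ENNReal.ofReal_ne_top hg.2.ne)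
    (eLpNorm_le_mul_eLpNorm_of_ae_le_mul h p)

theorem groundEnergy_le_of_hasWeakDeriv {A : Space →ₗ[ℝ] Space} {Ω : Set Space} {u : Space → ℂ}
    {m r : Fin 3 → Space → ℂ} (hu : MemLp u 2 (volume.restrict Ω))
    (hu0 : 0 < lpNorm u 2 (volume.restrict Ω)) (hm : ∀ j, MemLp (m j) 2 (volume.restrict Ω))
    (hr : ∀ j, MemLp (r j) 2 (volume.restrict Ω))
    (hder : ∀ j, HasWeakDeriv Ω (stdVec j) u
      fun x => Complex.I * (m j x + r j x + ((A x j : ℝ) : ℂ) * u x)) :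
    groundEnergy A Ω ≤ (((√(∑ j, lpNorm (m j) 2 (volume.restrict Ω) ^ 2) +
      ∑ j, lpNorm (r j) 2 (volume.restrict Ω)) / lpNorm u 2 (volume.restrict Ω)) ^ 2 : ℝ) := by
  have norm_toLp {f : Space → ℂ} (hf : MemLp f 2 (volume.restrict Ω)) :
      ‖hf.toLp‖ = lpNorm f 2 (volume.restrict Ω) := by
    rw [Lp.norm_toLp, toReal_eLpNorm hf.1]
  set M : PiLp 2 (fun _ : Fin 3 => L2 Ω) := WithLp.toLp 2 fun j => (hm j).toLp
  set R : PiLp 2 (fun _ : Fin 3 => L2 Ω) := WithLp.toLp 2 fun j => (hr j).toLp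
  have hu0' : hu.toLp ≠ 0 := by rwa [← norm_pos_iff, norm_toLp]
  have hmem : (hu.toLp, M + R) ∈ magneticGradient A Ω := fun j => by
    refine (hder j).congr_ae hu.coeFn_toLp.symm ?_
    filter_upwards [hu.coeFn_toLp, (hm j).coeFn_toLp, (hr j).coeFn_toLp,
      Lp.coeFn_add (hm j).toLp (hr j).toLp] with x hux hmx hrx hadd
    change _ = Complex.I * (((hm j).toLp + (hr j).toLp : L2 Ω) x + A x j * hu.toLp u x)
    rw [hadd, Pi.add_apply, hux, hmx, hrx]
  have hM : ‖M‖ = √(∑ j, lpNorm (m j) 2 (volume.restrict Ω) ^ 2) := by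
    simp_rw [PiLp.norm_eq_of_L2, M, norm_toLp]
  have hR : ‖R‖ ≤ ∑ j, lpNorm (r j) 2 (volume.restrict Ω) := by
    simp_rw [PiLp.norm_eq_of_L2, R, norm_toLp]
    exact Real.sqrt_le_iff.2 ⟨Finset.sum_nonneg fun j _ => lpNorm_nonneg,
      Finset.sum_sq_le_sq_sum_of_nonneg fun j _ => lpNorm_nonneg⟩
  refine (groundEnergy_le_rayleighQuotient hu0' hmem).trans (EReal.coe_le_coe_iff.2 ?_)
  rw [norm_toLp, ← hM]
  have hw : ‖M + R‖ ≤ ‖M‖ + ∑ j, lpNorm (r j) 2 (volume.restrict Ω) :=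
    (norm_add_le M R).trans (by gcongr)
  gcongr

variable {B : Space} {θ : Space → ℝ} {β κ T τ : ℝ} {f f' g : ℝ → ℂ}

/-- The part of the magnetic gradient of the trial function that stays as the wedge closes: the
gradient of the half-line form with parameter `τ`, up to a factor of modulus `√|b₂|`. -/
def mainTerm (B : Space) (θ : Space → ℝ) (β κ τ : ℝ) (f f' g : ℝ → ℂ) : Fin 3 → Space → ℂ :=
  ![(-Complex.I * β) • gaugedProduct θ β κ f' g, 0,
    ((B 1 / β : ℝ) : ℂ) • gaugedProduct θ β κ (fun r => ((r - τ : ℝ) : ℂ) * f r) g]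

/-- The part of the magnetic gradient of the trial function that vanishes as the wedge closes: the
components of the field other than `b₂`, and the slow variation along the edge. -/
def remainderTerm (B : Space) (θ : Space → ℝ) (β κ : ℝ) (f g : ℝ → ℂ) : Fin 3 → Space → ℂ :=
  ![fun x => ((B 2 * x 1 : ℝ) : ℂ) * gaugedProduct θ β κ f g x, 0,
    (fun x => ((-B 0 * x 1 : ℝ) : ℂ) * gaugedProduct θ β κ f g x) +
      (-Complex.I * κ) • gaugedProduct θ β κ f (deriv g)]

theorem hasWeakDeriv_trial {A : Space →ₗ[ℝ] Space} (hβ : 0 < β) (hT : 0 < T)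
    (hf : MemLp f 2 radialMeasure) (hf' : MemLp f' 2 radialMeasure)
    (hff' : HasWeakDeriv (Set.Ioi 0) 1 f f') (hθ : ContDiff ℝ ∞ θ)
    (hθA : ∀ x j, fderiv ℝ θ x (stdVec j) =
      A x j - axialPotential B x j - if 2 = j then B 1 / β * τ else 0)
    (hg : ContDiff ℝ ∞ g) (j : Fin 3) :
    HasWeakDeriv (openWedge T) (stdVec j) (gaugedProduct θ β κ f g) fun x =>
      Complex.I * (mainTerm B θ β κ τ f f' g j x + remainderTerm B θ β κ f g j x +
        ((A x j : ℝ) : ℂ) * gaugedProduct θ β κ f g x) := by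
  refine (hasWeakDeriv_gaugedProduct hβ hT hf hf' hff' hθ hg j).congr_ae .rfl
    (ae_of_all _ fun x => ?_)
  have hI := Complex.I_mul_I
  have hβ' : (B 1 / β * β : ℂ) = B 1 := div_mul_cancel₀ _ (Complex.ofReal_ne_zero.2 hβ.ne')
  simp only [hθA]
  fin_cases j
  · simp only [Fin.zero_eta, Fin.reduceEq, ↓reduceIte, mainTerm, remainderTerm, axialPotential,
      LinearMap.coe_mk, AddHom.coe_mk, Matrix.cons_val, Pi.smul_apply, smul_eq_mul]
    push_cast
    linear_combination β * gaugedProduct θ β κ f' g x * hI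
  · simp [mainTerm, remainderTerm, axialPotential, mul_assoc]
  · simp only [Fin.reduceFinMk, Fin.reduceEq, ↓reduceIte, mainTerm, remainderTerm, axialPotential,
      LinearMap.coe_mk, AddHom.coe_mk, Matrix.cons_val, Pi.add_apply, Pi.smul_apply, smul_eq_mul,
      gaugedProduct]
    push_cast
    linear_combination
      κ * (Complex.exp (Complex.I * θ x) * (f (β * x 0) * deriv g (κ * x 2))) * hI -
        Complex.I * x 0 * (Complex.exp (Complex.I * θ x) * (f (β * x 0) * g (κ * x 2))) * hβ'

theorem norm_transversalCoord_mul_gaugedProduct_le (hβ : 0 < β) (hT : 0 < T) (c : ℝ) {x : Space}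
    (hx : x ∈ openWedge T) :
    ‖((c * x 1 : ℝ) : ℂ) * gaugedProduct θ β κ f g x‖ ≤
      |c| * (T / β) * ‖gaugedProduct θ β κ (fun r : ℝ => (r : ℂ) * f r) g x‖ := by
  have hx1 : |x 1| ≤ T / β * |β * x 0| := by
    calc |x 1| ≤ x 0 * T := (show |x 1| < x 0 * T from hx).le
      _ = T / β * (β * x 0) := by field_simp
      _ ≤ T / β * |β * x 0| := by gcongr; exact le_abs_self _
  rw [norm_mul, Complex.norm_real, Real.norm_eq_abs, abs_mul, norm_gaugedProduct,
    norm_gaugedProduct, mul_assoc (Complex.ofReal _), norm_mul (Complex.ofReal _),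
    Complex.norm_real, Real.norm_eq_abs]
  calc |c| * |x 1| * ‖f (β * x 0) * g (κ * x 2)‖
      ≤ |c| * (T / β * |β * x 0|) * ‖f (β * x 0) * g (κ * x 2)‖ := by gcongr
    _ = |c| * (T / β) * (|β * x 0| * ‖f (β * x 0) * g (κ * x 2)‖) := by ring

theorem memLp_transversalCoord_mul_gaugedProduct (hβ : 0 < β) (hκ : 0 < κ) (hT : 0 < T)
    (hθ : Continuous θ) (hf : MemLp f 2 radialMeasure)
    (hrf : MemLp (fun r : ℝ => (r : ℂ) * f r) 2 radialMeasure) (hg : MemLp g 2 volume) (c : ℝ) :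
    MemLp (fun x => ((c * x 1 : ℝ) : ℂ) * gaugedProduct θ β κ f g x) 2
      (volume.restrict (openWedge T)) := by
  refine (memLp_gaugedProduct hβ hκ hT hθ hrf hg).of_le_mul (c := |c| * (T / β))
    (.mul (by fun_prop) (memLp_gaugedProduct hβ hκ hT hθ hf hg).1) ?_
  filter_upwards [ae_restrict_mem (isOpen_openWedge T).measurableSet] with x hx
  exact norm_transversalCoord_mul_gaugedProduct_le hβ hT c hx

theorem lpNorm_transversalCoord_mul_gaugedProduct_le (hβ : 0 < β) (hκ : 0 < κ) (hT : 0 < T)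
    (hθ : Continuous θ) (hf : MemLp f 2 radialMeasure)
    (hrf : MemLp (fun r : ℝ => (r : ℂ) * f r) 2 radialMeasure) (hg : MemLp g 2 volume) (c : ℝ) :
    lpNorm (fun x => ((c * x 1 : ℝ) : ℂ) * gaugedProduct θ β κ f g x) 2
      (volume.restrict (openWedge T)) ≤ |c| * (T / β) *
        lpNorm (gaugedProduct θ β κ (fun r : ℝ => (r : ℂ) * f r) g) 2
          (volume.restrict (openWedge T)) := by
  refine lpNorm_le_mul_lpNorm_of_ae_le_mul (by positivity)
    (memLp_transversalCoord_mul_gaugedProduct hβ hκ hT hθ hf hrf hg c).1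
    (memLp_gaugedProduct hβ hκ hT hθ hrf hg) ?_
  filter_upwards [ae_restrict_mem (isOpen_openWedge T).measurableSet] with x hx
  exact norm_transversalCoord_mul_gaugedProduct_le hβ hT c hx

theorem memLp_mainTerm (hβ : 0 < β) (hκ : 0 < κ) (hT : 0 < T) (hθ : Continuous θ)
    (hf' : MemLp f' 2 radialMeasure)
    (hτf : MemLp (fun r => ((r - τ : ℝ) : ℂ) * f r) 2 radialMeasure) (hg : MemLp g 2 volume)
    (j : Fin 3) : MemLp (mainTerm B θ β κ τ f f' g j) 2 (volume.restrict (openWedge T)) := by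
  fin_cases j
  exacts [(memLp_gaugedProduct hβ hκ hT hθ hf' hg).const_smul _, MemLp.zero,
    (memLp_gaugedProduct hβ hκ hT hθ hτf hg).const_smul _]

theorem sum_sq_lpNorm_mainTerm (hβ : 0 < β) (hβB : β ^ 2 = |B 1|) (hκ : 0 < κ) (hT : 0 < T)
    (hθ : Continuous θ) (hf' : MemLp f' 2 radialMeasure)
    (hτf : MemLp (fun r => ((r - τ : ℝ) : ℂ) * f r) 2 radialMeasure) (hg : MemLp g 2 volume) :
    ∑ j, lpNorm (mainTerm B θ β κ τ f f' g j) 2 (volume.restrict (openWedge T)) ^ 2 =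
      (√(2 * T / (β ^ 2 * κ)) * lpNorm g 2 volume * β) ^ 2 * (lpNorm f' 2 radialMeasure ^ 2 +
        lpNorm (fun r => ((r - τ : ℝ) : ℂ) * f r) 2 radialMeasure ^ 2) := by
  have h0 : ‖-Complex.I * (β : ℂ)‖ = β := by simp [hβ.le]
  have h2 : ‖((B 1 / β : ℝ) : ℂ)‖ = β := by
    rw [Complex.norm_real, Real.norm_eq_abs, abs_div, abs_of_pos hβ, ← hβB]
    field_simp
  simp only [Fin.sum_univ_three, mainTerm, Matrix.cons_val, lpNorm_zero, lpNorm_const_smul,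
    coe_nnnorm, h0, h2, lpNorm_gaugedProduct hβ hκ hT hθ hf' hg,
    lpNorm_gaugedProduct hβ hκ hT hθ hτf hg]
  ring

theorem memLp_remainderTerm (hβ : 0 < β) (hκ : 0 < κ) (hT : 0 < T) (hθ : Continuous θ)
    (hf : MemLp f 2 radialMeasure) (hrf : MemLp (fun r : ℝ => (r : ℂ) * f r) 2 radialMeasure)
    (hg : MemLp g 2 volume) (hg' : MemLp (deriv g) 2 volume) (j : Fin 3) :
    MemLp (remainderTerm B θ β κ f g j) 2 (volume.restrict (openWedge T)) := by
  have hx (c : ℝ) := memLp_transversalCoord_mul_gaugedProduct hβ hκ hT hθ hf hrf hg c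
  fin_cases j
  exacts [hx _, MemLp.zero, (hx _).add ((memLp_gaugedProduct hβ hκ hT hθ hf hg').const_smul _)]

theorem sum_lpNorm_remainderTerm_le (hβ : 0 < β) (hκ : 0 < κ) (hT : 0 < T) (hθ : Continuous θ)
    (hf : MemLp f 2 radialMeasure) (hrf : MemLp (fun r : ℝ => (r : ℂ) * f r) 2 radialMeasure)
    (hg : MemLp g 2 volume) (hg' : MemLp (deriv g) 2 volume) :
    ∑ j, lpNorm (remainderTerm B θ β κ f g j) 2 (volume.restrict (openWedge T)) ≤
      √(2 * T / (β ^ 2 * κ)) * ((|B 0| + |B 2|) * (T / β) *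
        (lpNorm (fun r : ℝ => (r : ℂ) * f r) 2 radialMeasure * lpNorm g 2 volume) +
          κ * (lpNorm f 2 radialMeasure * lpNorm (deriv g) 2 volume)) := by
  have hr0 := lpNorm_transversalCoord_mul_gaugedProduct_le hβ hκ hT hθ hf hrf hg (B 2)
  have hr2 := lpNorm_transversalCoord_mul_gaugedProduct_le hβ hκ hT hθ hf hrf hg (-B 0)
  have hadd := lpNorm_add_le (p := 2) (memLp_transversalCoord_mul_gaugedProduct hβ hκ hT hθ hf hrf
    hg (-B 0)) (g := (-Complex.I * κ) • gaugedProduct θ β κ f (deriv g)) one_le_two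
  have hκ' : ‖-Complex.I * (κ : ℂ)‖ = κ := by simp [hκ.le]
  simp only [Fin.sum_univ_three, remainderTerm, Matrix.cons_val, lpNorm_zero]
  rw [lpNorm_const_smul, coe_nnnorm, hκ'] at hadd
  rw [lpNorm_gaugedProduct hβ hκ hT hθ hrf hg] at hr0 hr2
  rw [lpNorm_gaugedProduct hβ hκ hT hθ hf hg'] at hadd
  rw [abs_neg] at hr2
  linarith

end EnergyOfTrialFunction

/-! ### The limit of small opening -/

section Asymptotics

variable {B : Space} {A : Space →ₗ[ℝ] Space} {θ : Space → ℝ} {β κ T τ : ℝ} {f f' g : ℝ → ℂ}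

theorem groundEnergy_openWedge_le (hA : curl A = B) (hβ : 0 < β) (hβB : β ^ 2 = |B 1|)
    (hf : MemLp f 2 radialMeasure) (hf0 : 0 < lpNorm f 2 radialMeasure)
    (hf' : MemLp f' 2 radialMeasure) (hff' : HasWeakDeriv (Set.Ioi 0) 1 f f')
    (hrf : MemLp (fun r : ℝ => (r : ℂ) * f r) 2 radialMeasure)
    (hτf : MemLp (fun r => ((r - τ : ℝ) : ℂ) * f r) 2 radialMeasure)
    (hg : ContDiff ℝ ∞ g) (hg2 : MemLp g 2 volume) (hg'2 : MemLp (deriv g) 2 volume)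
    (hg0 : 0 < lpNorm g 2 volume) (hT : 0 < T) :
    groundEnergy A (openWedge T) ≤ (((β * (√(lpNorm f' 2 radialMeasure ^ 2 +
        lpNorm (fun r => ((r - τ : ℝ) : ℂ) * f r) 2 radialMeasure ^ 2) / lpNorm f 2 radialMeasure) +
      T * ((|B 0| + |B 2|) / β *
        (lpNorm (fun r : ℝ => (r : ℂ) * f r) 2 radialMeasure / lpNorm f 2 radialMeasure) +
          lpNorm (deriv g) 2 volume / lpNorm g 2 volume)) ^ 2 : ℝ) : EReal) := by
  obtain ⟨θ, hθ, hθA⟩ := exists_gaugePhase hA (B 1 / β * τ)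
  have hu := lpNorm_gaugedProduct hβ hT hT hθ.continuous hf hg2
  have hmain := sum_sq_lpNorm_mainTerm hβ hβB hT hT hθ.continuous hf' hτf hg2
  have hrem := sum_lpNorm_remainderTerm_le (B := B) hβ hT hT hθ.continuous hf hrf hg2 hg'2
  have hu0 : 0 < lpNorm (gaugedProduct θ β T f g) 2 (volume.restrict (openWedge T)) := by
    rw [hu]
    positivity
  refine (groundEnergy_le_of_hasWeakDeriv (memLp_gaugedProduct hβ hT hT hθ.continuous hf hg2) hu0
    (memLp_mainTerm hβ hT hT hθ.continuous hf' hτf hg2)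
    (memLp_remainderTerm hβ hT hT hθ.continuous hf hrf hg2 hg'2)
    (hasWeakDeriv_trial hβ hT hf hf' hff' hθ hθA hg)).trans (EReal.coe_le_coe_iff.2 ?_)
  have hrem0 : 0 ≤ ∑ j, lpNorm (remainderTerm B θ β T f g j) 2 (volume.restrict (openWedge T)) :=
    Finset.sum_nonneg fun j _ => lpNorm_nonneg
  gcongr
  rw [div_le_iff₀ hu0, hmain, Real.sqrt_mul (sq_nonneg _), Real.sqrt_sq (by positivity), hu]
  refine (add_le_add_right hrem _).trans_eq ?_
  field_simp

theorem exists_cutoff : ∃ g : ℝ → ℂ, ContDiff ℝ ∞ g ∧ MemLp g 2 volume ∧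
    MemLp (deriv g) 2 volume ∧ 0 < lpNorm g 2 volume := by
  let bump : ContDiffBump (0 : ℝ) := ⟨1, 2, one_pos, one_lt_two⟩
  have hg : ContDiff ℝ ∞ fun x => (bump x : ℂ) := Complex.ofRealCLM.contDiff.comp bump.contDiff
  have hc : HasCompactSupport fun x => (bump x : ℂ) :=
    bump.hasCompactSupport.comp_left Complex.ofReal_zero
  have hg2 := hg.continuous.memLp_of_hasCompactSupport (μ := volume) (p := 2) hc
  refine ⟨_, hg, hg2, (hg.continuous_deriv (by simp)).memLp_of_hasCompactSupport hc.deriv,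
    lpNorm_nonneg.lt_of_ne' fun h => ?_⟩
  rw [lpNorm_eq_zero hg2 two_ne_zero, hg.continuous.ae_eq_iff_eq _ continuous_zero] at h
  simpa [bump.one_of_mem_closedBall (Metric.mem_closedBall_self bump.rIn_pos.le)] using
    congrFun h 0

theorem tendsto_tan_half : Tendsto (fun α : ℝ => Real.tan (α / 2)) (𝓝[>] 0) (𝓝 0) := by
  have h : ContinuousAt (fun α : ℝ => Real.tan (α / 2)) 0 :=
    ContinuousAt.comp (g := Real.tan) (Real.continuousAt_tan.2 (by simp)) (by fun_prop)
  simpa using h.tendsto.mono_left nhdsWithin_le_nhds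

theorem norm_eq_lpNorm {X : Type*} [MeasurableSpace X] {μ : Measure X} {p : ℝ≥0∞}
    (u : Lp ℂ p μ) : ‖u‖ = lpNorm u p μ := by
  rw [Lp.norm_def, toReal_eLpNorm (Lp.aestronglyMeasurable u)]

theorem norm_of_mem_radialGradient {u : L2r} {w : PiLp 2 (fun _ : Fin 2 => L2r)}
    (huw : (u, w) ∈ radialGradient τ) :
    ‖w‖ = √(lpNorm (w 0) 2 radialMeasure ^ 2 +
      lpNorm (fun r => ((r - τ : ℝ) : ℂ) * u r) 2 radialMeasure ^ 2) := by
  have h1 : ‖w 1‖ = lpNorm (fun r => ((r - τ : ℝ) : ℂ) * u r) 2 radialMeasure := by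
    rw [Lp.norm_def, eLpNorm_congr_ae huw.2,
      toReal_eLpNorm ((Lp.aestronglyMeasurable (w 1)).congr huw.2)]
  rw [PiLp.norm_eq_of_L2, Fin.sum_univ_two, h1, norm_eq_lpNorm]

theorem limsup_groundEnergy_wedge_le (hA : curl A = B) (hB : B 1 ≠ 0) {u : L2r}
    {w : PiLp 2 (fun _ : Fin 2 => L2r)} (hu : u ≠ 0) (huw : (u, w) ∈ radialGradient τ) :
    limsup (fun α : ℝ => groundEnergy A (interior (wedge α))) (𝓝[>] 0) ≤
      ((|B 1| * (‖w‖ / ‖u‖) ^ 2 : ℝ) : EReal) := by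
  have hw := norm_of_mem_radialGradient huw
  have hu0 : 0 < lpNorm u 2 radialMeasure := norm_eq_lpNorm u ▸ norm_pos_iff.2 hu
  have hτu : MemLp (fun r => ((r - τ : ℝ) : ℂ) * u r) 2 radialMeasure :=
    (memLp_congr_ae huw.2).1 (Lp.memLp (w 1))
  have hru : MemLp (fun r : ℝ => (r : ℂ) * u r) 2 radialMeasure := by
    refine (memLp_congr_ae (ae_of_all _ fun r => ?_)).1
      (hτu.add ((Lp.memLp u).const_mul (τ : ℂ)))
    simp only [Pi.add_apply]
    push_cast
    ring
  obtain ⟨g, hg, hg2, hg'2, hg0⟩ := exists_cutoff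
  have hβ : 0 < √|B 1| := Real.sqrt_pos.2 (abs_pos.2 hB)
  have hβB : √|B 1| ^ 2 = |B 1| := Real.sq_sqrt (abs_nonneg _)
  have hbound {T : ℝ} (hT : 0 < T) := groundEnergy_openWedge_le hA hβ hβB (Lp.memLp u) hu0
    (Lp.memLp (w 0)) huw.1 hru hτu hg hg2 hg'2 hg0 hT
  rw [← hw, ← norm_eq_lpNorm] at hbound
  set C : ℝ := (|B 0| + |B 2|) / √|B 1| *
    (lpNorm (fun r : ℝ => (r : ℂ) * u r) 2 radialMeasure / ‖u‖) +
      lpNorm (deriv g) 2 volume / lpNorm g 2 volume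
  have hlim : Tendsto (fun α : ℝ => (√|B 1| * (‖w‖ / ‖u‖) + Real.tan (α / 2) * C) ^ 2)
      (𝓝[>] 0) (𝓝 (|B 1| * (‖w‖ / ‖u‖) ^ 2)) := by
    simpa only [zero_mul, add_zero, mul_pow, hβB] using
      ((tendsto_tan_half.mul_const C).const_add (√|B 1| * (‖w‖ / ‖u‖))).pow 2
  rw [← ((continuous_coe_real_ereal.tendsto _).comp hlim).limsup_eq]
  refine limsup_le_limsup ?_
  filter_upwards [Ioo_mem_nhdsGT Real.pi_pos] with α hα
  rw [interior_wedge hα.1 hα.2]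
  exact hbound (Real.tan_pos_of_pos_of_lt_pi_div_two (by linarith [hα.1]) (by linarith [hα.2]))

end Asymptotics

end MagneticWedge

end

theorem corollary5p3_general (B : MagneticWedge.Space) (hB : B 1 ≠ 0)
    (A : MagneticWedge.Space →ₗ[ℝ] MagneticWedge.Space) (hA : MagneticWedge.curl A = B) :
    Filter.limsup
        (fun α : ℝ => MagneticWedge.groundEnergy A (interior (MagneticWedge.wedge α)))
        (nhdsWithin 0 (Set.Ioi 0)) ≤
      ((|B 1| : ℝ) : EReal) * MagneticWedge.Xi0 := by
  have hpos : (0 : EReal) < ((|B 1| : ℝ) : EReal) := EReal.coe_pos.2 (abs_pos.2 hB)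
  rw [← EReal.div_le_iff_le_mul hpos (EReal.coe_ne_top _)]
  refine le_iInf fun τ => le_iInf₂ fun t ⟨u, hu, ht⟩ => ?_
  obtain ⟨w, huw, hw⟩ := MagneticWedge.norm_sq_eq_of_mem_formOperator ht
  have hquot : (‖w‖ / ‖u‖) ^ 2 = t := by
    rw [div_pow, hw, mul_div_cancel_right₀ _ (pow_ne_zero 2 (norm_ne_zero_iff.2 hu))]
  rw [EReal.div_le_iff_le_mul hpos (EReal.coe_ne_top _), ← EReal.coe_mul, ← hquot]
  exact MagneticWedge.limsup_groundEnergy_wedge_le hA hB hu huw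

theorem corollary5p3 (B : MagneticWedge.Space) (hB : ‖B‖ = 1) (hB2 : 0 < B 1)
    (A : MagneticWedge.Space →ₗ[ℝ] MagneticWedge.Space) (hA : MagneticWedge.curl A = B) :
    Filter.limsup
        (fun α : ℝ => MagneticWedge.groundEnergy A (interior (MagneticWedge.wedge α)))
        (nhdsWithin 0 (Set.Ioi 0)) ≤
      ((B 1 : ℝ) : EReal) * MagneticWedge.Xi0 := by
  simpa only [abs_of_pos hB2] using corollary5p3_general B hB2.ne' A hA
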